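/- Let $H$ be the distribution of a positive random variable $U$ with $k_1=\mathrm{E}\{U^{-1/2}\}<\infty$. For $\mu\in\mathbb{R}^p$, a positive definite $p\times p$ matrix $\Sigma$ and $\lambda\in\mathbb{R}^p$, let $\mathrm{SMSN}_p(\mu,\Sigma,\lambda;H)$ be the distribution on $\mathbb{R}^p$ with Lebesgue density $$f(y)=2\int_0^\infty \phi_p(y;\mu,u^{-1}\Sigma)\,\Phi\!\left(u^{1/2}\lambda^\top\Sigma^{-1/2}(y-\mu)\right)dH(u),$$ where $\phi_p(\cdot;\mu,\Sigma)$ is the $\mathrm{N}_p(\mu,\Sigma)$ density, $\Phi$ is the standard normal cdf, $\Sigma^{1/2}$ is the positive definite square root and $\Sigma^{-1/2}$ its inverse. For subjects $i=1,\dots,N$ consider the linear mixed model $Y_i=X_i\beta+Z_ib_i+\epsilon_i$ with $X_i\in\mathbb{R}^{n_i\times l}$, $Z_i\in\mathbb{R}^{n_i\times q}$, $\beta\in\mathbb{R}^l$, where the vectors $(b_i^\top,\epsilon_i^\top)^\top$, $i=1,\dots,N$, are independent and $$\begin{pmatrix}b_i\\ \epsilon_i\end{pmatrix}\sim \mathrm{SMSN}_{q+n_i}\left(\begin{pmatrix}c\Delta\\0\end{pmatrix},\begin{pmatrix}D&0\\0&\Sigma_i\end{pmatrix},\begin{pmatrix}\lambda\\0\end{pmatrix};H\right),$$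 with $D$ ($q\times q$) and $\Sigma_i$ ($n_i\times n_i$) positive definite, $\lambda\in\mathbb{R}^q$, $c=-\sqrt{2/\pi}\,k_1$, $\Delta=D^{1/2}\delta$ and $\delta=\lambda/\sqrt{1+\lambda^\top\lambda}$. Then $Y_1,\dots,Y_N$ are independent and, for every $i$, $$Y_i\sim \mathrm{SMSN}_{n_i}(X_i\beta+cZ_i\Delta,\ \Psi_i,\ \bar\lambda_i;H),\qquad \Psi_i=\Sigma_i+Z_iDZ_i^\top,\qquad \bar\lambda_i=\frac{\Psi_i^{-1/2}Z_iD\zeta}{\sqrt{1+\zeta^\top\Lambda_i\zeta}},$$ where $\zeta=D^{-1/2}\lambda$ and $\Lambda_i=(D^{-1}+Z_i^\top\Sigma_i^{-1}Z_i)^{-1}$. Hence $Y_i$ has a Lebesgue density, which is given for almost every $y\in\mathbb{R}^{n_i}$ by $$f(y)=2\int_0^\infty\phi_{n_i}(y;X_i\beta+cZ_i\Delta,u^{-1}\Psi_i)\,\Phi\!\left(u^{1/2}\bar\lambda_i^\top\Psi_i^{-1/2}(y-X_i\beta-cZ_i\Delta)\right)dH(u).$$ -/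

import Mathlib

open MeasureTheory ProbabilityTheory Matrix
open scoped MatrixOrder

/-- The cdf `Φ` of the standard normal distribution on the line. -/
noncomputable def stdNormalCdf (x : ℝ) : ℝ := cdf (gaussianReal 0 1) x

/-- The density `φ_p(y; μ, S)` of the `p`-variate normal distribution with mean vector `μ` and
(positive definite) covariance matrix `S`, where `p` is the number of elements of `ι`. -/
noncomputable def normalPdf {ι : Type*} [Fintype ι] [DecidableEq ι]
    (μ : ι → ℝ) (S : Matrix ι ι ℝ) (y : ι → ℝ) : ℝ :=
  (√((2 * Real.pi) ^ Fintype.card ι * S.det))⁻¹ *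
    Real.exp (-(1 / 2) * ((y - μ) ⬝ᵥ S⁻¹ *ᵥ (y - μ)))

/-- `S^{1/2}`: the positive semidefinite square root of a positive semidefinite matrix. -/
noncomputable def matSqrt {ι : Type*} [Fintype ι] [DecidableEq ι]
    (S : Matrix ι ι ℝ) : Matrix ι ι ℝ := CFC.sqrt S

/-- `S^{-1/2}`: the inverse of the square root of a positive definite matrix. -/
noncomputable def matInvSqrt {ι : Type*} [Fintype ι] [DecidableEq ι]
    (S : Matrix ι ι ℝ) : Matrix ι ι ℝ := (matSqrt S)⁻¹

/-- The density of the scale mixture of skew-normal distributions with location `μ`, dispersion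
matrix `S`, skewness vector `lam`, mixing distribution `H` and weight function `κ(u) = 1/u`:
`f(y) = 2 ∫_0^∞ φ_p(y; μ, u⁻¹ S) Φ(u^{1/2} lamᵀ S^{-1/2} (y - μ)) dH(u)`.
The integrand is nonnegative, and the integral is taken in `[0, ∞]` (it may be infinite at the one
point `y = μ`). -/
noncomputable def smsnPdf {ι : Type*} [Fintype ι] [DecidableEq ι]
    (μ : ι → ℝ) (S : Matrix ι ι ℝ) (lam : ι → ℝ) (H : Measure ℝ) (y : ι → ℝ) : ENNReal :=
  2 * ∫⁻ u in Set.Ioi (0 : ℝ),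
    ENNReal.ofReal (normalPdf μ (u⁻¹ • S) y *
      stdNormalCdf (√u * (lam ⬝ᵥ matInvSqrt S *ᵥ (y - μ)))) ∂H

/-- The distribution `SMSN_p(μ, S, lam; H)` on `ℝ^p`: the measure with density `smsnPdf` with
respect to Lebesgue measure. -/
noncomputable def smsn {ι : Type*} [Fintype ι] [DecidableEq ι]
    (μ : ι → ℝ) (S : Matrix ι ι ℝ) (lam : ι → ℝ) (H : Measure ℝ) : Measure (ι → ℝ) :=
  (volume : Measure (ι → ℝ)).withDensity (smsnPdf μ S lam H)

/-- `δ = λ / √(1 + λᵀ λ)`. -/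
noncomputable def skewDelta {ι : Type*} [Fintype ι] (lam : ι → ℝ) : ι → ℝ :=
  (√(1 + lam ⬝ᵥ lam))⁻¹ • lam

/-- `Δ = D^{1/2} δ`. -/
noncomputable def bigDelta {ι : Type*} [Fintype ι] [DecidableEq ι]
    (D : Matrix ι ι ℝ) (lam : ι → ℝ) : ι → ℝ :=
  matSqrt D *ᵥ skewDelta lam

/-- `c = -√(2/π) k₁`, where `k₁ = E[U^{-1/2}]` for `U ∼ H`. -/
noncomputable def centering (H : Measure ℝ) : ℝ :=
  -√(2 / Real.pi) * ∫ u, (√u)⁻¹ ∂H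

/-- `Ψ = Σ + Z D Zᵀ`. -/
def margDispersion {m q : ℕ} (D : Matrix (Fin q) (Fin q) ℝ) (S : Matrix (Fin m) (Fin m) ℝ)
    (Z : Matrix (Fin m) (Fin q) ℝ) : Matrix (Fin m) (Fin m) ℝ :=
  S + Z * D * Zᵀ

/-- `Λ = (D⁻¹ + Zᵀ Σ⁻¹ Z)⁻¹`. -/
noncomputable def bigLambda {m q : ℕ} (D : Matrix (Fin q) (Fin q) ℝ)
    (S : Matrix (Fin m) (Fin m) ℝ) (Z : Matrix (Fin m) (Fin q) ℝ) : Matrix (Fin q) (Fin q) ℝ :=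
  (D⁻¹ + Zᵀ * S⁻¹ * Z)⁻¹

/-- `ζ = D^{-1/2} λ`. -/
noncomputable def zetaVec {q : ℕ} (D : Matrix (Fin q) (Fin q) ℝ) (lam : Fin q → ℝ) : Fin q → ℝ :=
  matInvSqrt D *ᵥ lam

/-- `λ̄ = Ψ^{-1/2} Z D ζ / √(1 + ζᵀ Λ ζ)`. -/
noncomputable def margSkewness {m q : ℕ} (D : Matrix (Fin q) (Fin q) ℝ)
    (S : Matrix (Fin m) (Fin m) ℝ) (Z : Matrix (Fin m) (Fin q) ℝ) (lam : Fin q → ℝ) :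
    Fin m → ℝ :=
  (√(1 + zetaVec D lam ⬝ᵥ bigLambda D S Z *ᵥ zetaVec D lam))⁻¹ •
    (matInvSqrt (margDispersion D S Z) * Z * D) *ᵥ zetaVec D lam

/-- The location vector `X β + c Z Δ` of the response. -/
noncomputable def margLocation {m l q : ℕ} (X : Matrix (Fin m) (Fin l) ℝ) (β : Fin l → ℝ)
    (Z : Matrix (Fin m) (Fin q) ℝ) (D : Matrix (Fin q) (Fin q) ℝ) (lam : Fin q → ℝ)
    (H : Measure ℝ) : Fin m → ℝ :=
  X *ᵥ β + centering H • Z *ᵥ bigDelta D lam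

/-! Each response is a fixed affine image of its pair (b, ε), so independence is inherited, and the
law of the response is found by substituting ε = y - Xβ - Zx in the joint density and integrating
out x. Tonelli reduces this to a fixed mixing value u > 0.

For fixed u the Gaussian part factors as marginal times posterior (`normalPdf_mul_normalPdf`): the
marginal of y has dispersion Ψ/u, and the random effect given y is normal with dispersion Λ/u. The
skewing factor involves only x, through ζ, because the dispersion is block diagonal and the error
has zero skewness. What remains is a posterior average of Φ(α + tᵀx) with t = √u ζ, which
`lintegral_normalPdf_mul_stdNormalCdf` evaluates. There tᵀ(Λ/u)t = ζᵀΛζ, so u cancels and the new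
skewness does not depend on it. The identity ΛZᵀΣ⁻¹ = DZᵀΨ⁻¹ then puts the argument in the form that
defines λ̄. -/

/-! ### Gaussian averages of Φ -/

lemma ofReal_stdNormalCdf (x : ℝ) :
    ENNReal.ofReal (stdNormalCdf x) = gaussianReal 0 1 (Set.Iic x) :=
  ofReal_cdf _ x

lemma measurable_stdNormalCdf : Measurable stdNormalCdf := (monotone_cdf _).measurable

/-- With T standard normal and X ∼ N(0, v) independent, Φ(α - x) is the probability of T + x ≤ α.
The average is thus P(T + X ≤ α), and T + X ∼ N(0, 1 + v). -/
lemma lintegral_stdNormalCdf_gaussianReal (α : ℝ) (v : NNReal) :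
    ∫⁻ x, ENNReal.ofReal (stdNormalCdf (α - x)) ∂(gaussianReal 0 v) =
      ENNReal.ofReal (stdNormalCdf ((√(1 + v))⁻¹ * α)) := by
  have h : gaussianReal 0 1 ∗ gaussianReal 0 v = gaussianReal 0 (1 + v) := by
    rw [gaussianReal_conv_gaussianReal, add_zero]
  have hv : (0 : ℝ) < √(1 + v) := by positivity
  have h1 : ∫⁻ x, ENNReal.ofReal (stdNormalCdf (α - x)) ∂(gaussianReal 0 v) =
      gaussianReal 0 (1 + v) (Set.Iic α) := by
    rw [← h, Measure.conv, Measure.map_apply (by fun_prop) measurableSet_Iic,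
      Measure.prod_apply_symm (measurableSet_Iic.preimage (by fun_prop))]
    refine lintegral_congr fun x => ?_
    rw [ofReal_stdNormalCdf]
    congr 1
    ext t
    simp [le_sub_iff_add_le]
  have h2 : gaussianReal 0 (1 + v) = (gaussianReal 0 1).map (√(1 + (v : ℝ)) * ·) := by
    rw [gaussianReal_map_const_mul, mul_zero, mul_one]
    congr 1
    ext
    simp [Real.sq_sqrt (show (0 : ℝ) ≤ 1 + v by positivity)]
  rw [h1, h2, Measure.map_apply (by fun_prop) measurableSet_Iic, ofReal_stdNormalCdf]
  congr 1
  ext t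
  simp [le_inv_mul_iff₀ hv]

section

variable {ι : Type*} [Fintype ι]

lemma map_dotProduct_pi_gaussianReal (s : ι → ℝ) :
    (Measure.pi fun _ : ι => gaussianReal 0 1).map (fun w => w ⬝ᵥ s) =
      gaussianReal 0 (s ⬝ᵥ s).toNNReal := by
  refine Measure.ext_of_charFun (funext fun t => ?_)
  have h : (Measure.pi fun _ : ι => gaussianReal 0 1).map (fun w => w ⬝ᵥ s) =
      (Measure.pi fun i : ι => gaussianReal 0 (s i ^ 2).toNNReal).map fun p => ∑ i, p i := by
    have : ∀ i, gaussianReal 0 (s i ^ 2).toNNReal = (gaussianReal 0 1).map (· * s i) := fun i => by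
      rw [gaussianReal_map_mul_const, mul_zero, mul_one]
      congr 1
      exact Real.toNNReal_of_nonneg (sq_nonneg _)
    simp_rw [this]
    rw [← Measure.pi_map_pi (fun i => by fun_prop), Measure.map_map (by fun_prop) (by fun_prop)]
    rfl
  rw [h, charFun_map_sum_pi_eq_prod, Finset.prod_apply]
  simp only [charFun_gaussianReal]
  rw [← Complex.exp_sum]
  congr 1
  have : ((s ⬝ᵥ s).toNNReal : ℝ) = ∑ i, s i ^ 2 := by
    rw [Real.coe_toNNReal (s ⬝ᵥ s) (dotProduct_self_star_nonneg s)]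
    simp [dotProduct, sq]
  simp [this, Finset.sum_div, Finset.sum_mul, Real.coe_toNNReal _ (sq_nonneg _)]

lemma lintegral_stdNormalCdf_pi_gaussianReal (α : ℝ) (s : ι → ℝ) :
    ∫⁻ w, ENNReal.ofReal (stdNormalCdf (α + s ⬝ᵥ w))
        ∂(Measure.pi fun _ : ι => gaussianReal 0 1) =
      ENNReal.ofReal (stdNormalCdf ((√(1 + s ⬝ᵥ s))⁻¹ * α)) := by
  have hs : 0 ≤ s ⬝ᵥ s := dotProduct_self_star_nonneg s
  have h := lintegral_stdNormalCdf_gaussianReal α (s ⬝ᵥ s).toNNReal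
  have hm := map_dotProduct_pi_gaussianReal (-s)
  rw [neg_dotProduct_neg] at hm
  have := measurable_stdNormalCdf
  rw [← hm, lintegral_map (by fun_prop) (by unfold dotProduct; fun_prop),
    Real.coe_toNNReal _ hs] at h
  rw [← h]
  refine lintegral_congr fun w => ?_
  rw [dotProduct_neg, sub_neg_eq_add, dotProduct_comm]

/-! ### The multivariate normal density and its affine normalization -/

variable [DecidableEq ι]

lemma normalPdf_nonneg (μ : ι → ℝ) (S : Matrix ι ι ℝ) (y : ι → ℝ) : 0 ≤ normalPdf μ S y := by
  unfold normalPdf; positivity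

@[fun_prop]
lemma continuous_normalPdf (μ : ι → ℝ) (S : Matrix ι ι ℝ) : Continuous (normalPdf μ S) := by
  unfold normalPdf; fun_prop

lemma normalPdf_zero_one (x : ι → ℝ) :
    normalPdf 0 1 x = ∏ i, gaussianPDFReal 0 1 (x i) := by
  simp only [normalPdf, gaussianPDFReal, Finset.prod_mul_distrib, ← Real.exp_sum]
  congr 1
  · have : √((2 * Real.pi) ^ Fintype.card ι) = √(2 * Real.pi) ^ Fintype.card ι := by
      rw [Real.sqrt_eq_iff_mul_self_eq (by positivity) (by positivity), ← mul_pow,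
        Real.mul_self_sqrt (by positivity)]
    rw [det_one, mul_one, this, Finset.prod_const, inv_pow, NNReal.coe_one, mul_one]
    rfl
  · simp only [dotProduct, Finset.mul_sum, inv_one, one_mulVec, sub_zero]
    congr 1
    refine Finset.sum_congr rfl fun i _ => ?_
    simp only [NNReal.coe_one]
    ring

lemma pi_gaussianReal_eq_withDensity :
    Measure.pi (fun _ : ι => gaussianReal 0 1) =
      volume.withDensity fun x => ENNReal.ofReal (normalPdf 0 1 x) := by
  refine Measure.pi_eq fun s hs => ?_
  rw [withDensity_apply _ (MeasurableSet.univ_pi hs)]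
  have h1 : ∀ i, gaussianReal 0 1 (s i) =
      ENNReal.ofReal (∫ x, (s i).indicator (gaussianPDFReal 0 1) x) := fun i => by
    rw [gaussianReal_apply_eq_integral _ one_ne_zero, integral_indicator (hs i)]
  simp_rw [h1]
  rw [← ENNReal.ofReal_prod_of_nonneg fun i _ => integral_nonneg fun x =>
      Set.indicator_nonneg (fun _ _ => gaussianPDFReal_nonneg _ _ _) _,
    ← integral_fintype_prod_eq_prod (𝕜 := ℝ), ← volume_pi, ofReal_integral_eq_lintegral_ofReal,
    ← lintegral_indicator (MeasurableSet.univ_pi hs)]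
  · refine lintegral_congr fun x => ?_
    by_cases hx : x ∈ Set.univ.pi s
    · rw [Set.indicator_of_mem hx, normalPdf_zero_one]
      congr 1
      exact Finset.prod_congr rfl fun i _ => (Set.indicator_of_mem (hx i trivial) _).symm
    · rw [Set.indicator_of_notMem hx]
      simp only [Set.mem_univ_pi, not_forall] at hx
      obtain ⟨i, hi⟩ := hx
      rw [Finset.prod_eq_zero (Finset.mem_univ i) (Set.indicator_of_notMem hi _),
        ENNReal.ofReal_zero]
  · exact Integrable.fintype_prod fun i => (integrable_gaussianPDFReal 0 1).indicator (hs i)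
  · exact Filter.Eventually.of_forall fun x => Finset.prod_nonneg fun i _ =>
      Set.indicator_nonneg (fun _ _ => gaussianPDFReal_nonneg _ _ _) _

lemma matSqrt_mul_self {V : Matrix ι ι ℝ} (hV : V.PosDef) : matSqrt V * matSqrt V = V :=
  CFC.sqrt_mul_sqrt_self V hV.posSemidef.nonneg

lemma matSqrt_posSemidef (V : Matrix ι ι ℝ) : (matSqrt V).PosSemidef :=
  (CFC.sqrt_nonneg V).posSemidef

lemma transpose_matSqrt (V : Matrix ι ι ℝ) : (matSqrt V)ᵀ = matSqrt V := by
  simpa [conjTranspose_eq_transpose_of_trivial] using (matSqrt_posSemidef V).isHermitian.eq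

lemma det_matSqrt_mul_self {V : Matrix ι ι ℝ} (hV : V.PosDef) :
    (matSqrt V).det * (matSqrt V).det = V.det := by
  rw [← det_mul, matSqrt_mul_self hV]

lemma det_matSqrt_ne_zero {V : Matrix ι ι ℝ} (hV : V.PosDef) : (matSqrt V).det ≠ 0 := fun h => by
  have := det_matSqrt_mul_self hV
  rw [h, mul_zero] at this
  exact hV.det_pos.ne this

lemma isUnit_det_matSqrt {V : Matrix ι ι ℝ} (hV : V.PosDef) : IsUnit (matSqrt V).det :=
  (det_matSqrt_ne_zero hV).isUnit

lemma normalPdf_add_matSqrt_mulVec (a : ι → ℝ) {V : Matrix ι ι ℝ} (hV : V.PosDef) (w : ι → ℝ) :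
    normalPdf a V (a + matSqrt V *ᵥ w) = |(matSqrt V).det|⁻¹ * normalPdf 0 1 w := by
  have hq : matSqrt V *ᵥ w ⬝ᵥ V⁻¹ *ᵥ (matSqrt V *ᵥ w) = w ⬝ᵥ w := by
    rw [dotProduct_comm, dotProduct_mulVec, ← mulVec_transpose, transpose_matSqrt,
      mulVec_mulVec, mulVec_mulVec, dotProduct_comm]
    nth_rw 2 [← matSqrt_mul_self hV]
    rw [Matrix.mul_inv_rev, ← Matrix.mul_assoc,
      Matrix.mul_nonsing_inv _ (isUnit_det_matSqrt hV), Matrix.one_mul,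
      Matrix.nonsing_inv_mul _ (isUnit_det_matSqrt hV), one_mulVec]
  have hd : √V.det = |(matSqrt V).det| := by
    rw [← det_matSqrt_mul_self hV, Real.sqrt_mul_self_eq_abs]
  simp only [normalPdf, add_sub_cancel_left, hq, sub_zero, inv_one, one_mulVec, det_one, mul_one]
  rw [Real.sqrt_mul (by positivity), hd, mul_inv]
  ring

/-- Change of variables x = a + V^{1/2} w, whose Jacobian |det V^{1/2}| = √(det V) is exactly the
ratio of the normalizing constants. -/
lemma lintegral_normalPdf_mul (a : ι → ℝ) {V : Matrix ι ι ℝ} (hV : V.PosDef)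
    {g : (ι → ℝ) → ENNReal} (hg : Measurable g) :
    ∫⁻ x, ENNReal.ofReal (normalPdf a V x) * g x =
      ∫⁻ w, g (a + matSqrt V *ᵥ w) ∂(Measure.pi fun _ : ι => gaussianReal 0 1) := by
  have hpos : 0 < |(matSqrt V).det| := abs_pos.2 (det_matSqrt_ne_zero hV)
  set h : (ι → ℝ) → ENNReal := fun x => ENNReal.ofReal (normalPdf a V x) * g x with hh
  have hm : Measurable h := by fun_prop
  have hm' : Measurable fun x => h (a + x) := by fun_prop
  have hlin : Measurable (toLin' (matSqrt V)) :=
    (LinearMap.continuous_of_finiteDimensional _).measurable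
  have key : ∫⁻ w, h (a + matSqrt V *ᵥ w) =
      ENNReal.ofReal |(matSqrt V).det|⁻¹ * ∫⁻ x, h x := by
    rw [← lintegral_add_left_eq_self h a, ← smul_eq_mul, ← abs_inv, ← lintegral_smul_measure,
      ← Real.map_matrix_volume_pi_eq_smul_volume_pi (det_matSqrt_ne_zero hV),
      lintegral_map hm' hlin]
    simp [toLin'_apply]
  have key2 : ∫⁻ w, h (a + matSqrt V *ᵥ w) = ENNReal.ofReal |(matSqrt V).det|⁻¹ *
      ∫⁻ w, ENNReal.ofReal (normalPdf 0 1 w) * g (a + matSqrt V *ᵥ w) := by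
    rw [← lintegral_const_mul _ (by fun_prop)]
    refine lintegral_congr fun w => ?_
    simp only [hh]
    rw [normalPdf_add_matSqrt_mulVec a hV, ENNReal.ofReal_mul (by positivity), mul_assoc]
  rw [pi_gaussianReal_eq_withDensity, lintegral_withDensity_eq_lintegral_mul _ (by fun_prop)
    (by fun_prop)]
  refine (ENNReal.mul_right_inj (a := ENNReal.ofReal |(matSqrt V).det|⁻¹) ?_
    ENNReal.ofReal_ne_top).1 (key.symm.trans key2)
  simpa using hpos

/-- If `x ∼ N(a, V)` then `E Φ(α + tᵀ x) = Φ((α + tᵀ a) / √(1 + tᵀ V t))`. -/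
lemma lintegral_normalPdf_mul_stdNormalCdf (a : ι → ℝ) {V : Matrix ι ι ℝ} (hV : V.PosDef)
    (α : ℝ) (t : ι → ℝ) :
    ∫⁻ x, ENNReal.ofReal (normalPdf a V x) * ENNReal.ofReal (stdNormalCdf (α + t ⬝ᵥ x)) =
      ENNReal.ofReal (stdNormalCdf ((√(1 + t ⬝ᵥ V *ᵥ t))⁻¹ * (α + t ⬝ᵥ a))) := by
  have hcdf := measurable_stdNormalCdf
  have hdot : Measurable fun x : ι → ℝ => t ⬝ᵥ x := by unfold dotProduct; fun_prop
  rw [lintegral_normalPdf_mul a hV (by fun_prop)]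
  have hq : t ⬝ᵥ V *ᵥ t = matSqrt V *ᵥ t ⬝ᵥ matSqrt V *ᵥ t := by
    nth_rw 1 [← matSqrt_mul_self hV]
    rw [← mulVec_mulVec, dotProduct_mulVec, ← mulVec_transpose, transpose_matSqrt]
  rw [hq, ← lintegral_stdNormalCdf_pi_gaussianReal]
  refine lintegral_congr fun w => ?_
  rw [dotProduct_add, dotProduct_mulVec, ← mulVec_transpose, transpose_matSqrt, add_assoc]

end

/-! ### Scaling, square roots and block-diagonal matrices -/

lemma inv_inv_smul {ι : Type*} [Fintype ι] [DecidableEq ι] {S : Matrix ι ι ℝ} (hS : IsUnit S.det)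
    (u : ℝ) : (u⁻¹ • S)⁻¹ = u • S⁻¹ := by
  -- At `u = 0` both sides are zero by the conventions for inverses; covering this case lets
  -- measurability be proved on all of ℝ.
  rcases eq_or_ne u 0 with rfl | hu
  · simp
  · refine Matrix.inv_eq_right_inv ?_
    rw [smul_mul_smul_comm, inv_mul_cancel₀ hu, one_smul, Matrix.mul_nonsing_inv _ hS]

lemma posDef_matSqrt {ι : Type*} [Fintype ι] [DecidableEq ι] {V : Matrix ι ι ℝ} (hV : V.PosDef) :
    (matSqrt V).PosDef :=
  (matSqrt_posSemidef V).posDef_iff_isUnit.2 <|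
    (Matrix.isUnit_iff_isUnit_det _).2 (isUnit_det_matSqrt hV)

lemma transpose_matInvSqrt {ι : Type*} [Fintype ι] [DecidableEq ι] (V : Matrix ι ι ℝ) :
    (matInvSqrt V)ᵀ = matInvSqrt V := by
  rw [matInvSqrt, transpose_nonsing_inv, transpose_matSqrt]

lemma matInvSqrt_mul_self {ι : Type*} [Fintype ι] [DecidableEq ι] {V : Matrix ι ι ℝ}
    (hV : V.PosDef) : matInvSqrt V * matInvSqrt V = V⁻¹ := by
  rw [matInvSqrt, ← Matrix.mul_inv_rev, matSqrt_mul_self hV]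

lemma sumElim_sub_sumElim {ι κ : Type*} (a b : ι → ℝ) (c d : κ → ℝ) :
    Sum.elim a c - Sum.elim b d = Sum.elim (a - b) (c - d) := by
  ext (i | i) <;> rfl

section Blocks

variable {ι κ : Type*} [Fintype ι] [DecidableEq ι] [Fintype κ]
  {A : Matrix ι ι ℝ} {B : Matrix κ κ ℝ}

lemma posSemidef_fromBlocks_zero (hA : A.PosDef) (hB : B.PosSemidef) :
    (fromBlocks A 0 0 B).PosSemidef := by
  have := hA.isUnit.invertible
  have h := hA.fromBlocks₁₁ (0 : Matrix ι κ ℝ) B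
  simp only [conjTranspose_zero, Matrix.zero_mul, sub_zero] at h
  exact h.2 hB

variable [DecidableEq κ]

lemma matSqrt_fromBlocks (hA : A.PosDef) (hB : B.PosDef) :
    matSqrt (fromBlocks A 0 0 B) = fromBlocks (matSqrt A) 0 0 (matSqrt B) := by
  refine CFC.sqrt_unique ?_
    (posSemidef_fromBlocks_zero (posDef_matSqrt hA) (matSqrt_posSemidef B)).nonneg
  simp [fromBlocks_multiply, matSqrt_mul_self hA, matSqrt_mul_self hB]

lemma posDef_fromBlocks_zero (hA : A.PosDef) (hB : B.PosDef) : (fromBlocks A 0 0 B).PosDef := by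
  refine (posSemidef_fromBlocks_zero hA hB.posSemidef).posDef_iff_isUnit.2 ?_
  rw [Matrix.isUnit_iff_isUnit_det, det_fromBlocks_zero₂₁]
  exact (mul_pos hA.det_pos hB.det_pos).ne'.isUnit

lemma inv_fromBlocks_zero (hA : IsUnit A.det) (hB : IsUnit B.det) :
    (fromBlocks A 0 0 B)⁻¹ = fromBlocks A⁻¹ 0 0 B⁻¹ := by
  refine Matrix.inv_eq_right_inv ?_
  simp [fromBlocks_multiply, Matrix.mul_nonsing_inv _ hA, Matrix.mul_nonsing_inv _ hB]

lemma matInvSqrt_fromBlocks (hA : A.PosDef) (hB : B.PosDef) :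
    matInvSqrt (fromBlocks A 0 0 B) = fromBlocks (matInvSqrt A) 0 0 (matInvSqrt B) := by
  rw [matInvSqrt, matSqrt_fromBlocks hA hB,
    inv_fromBlocks_zero (isUnit_det_matSqrt hA) (isUnit_det_matSqrt hB)]
  rfl

lemma normalPdf_fromBlocks (hA : A.PosDef) (hB : B.PosDef) (m x : ι → ℝ) (n y : κ → ℝ) :
    normalPdf (Sum.elim m n) (fromBlocks A 0 0 B) (Sum.elim x y) =
      normalPdf m A x * normalPdf n B y := by
  have hA' := hA.det_pos
  have hB' := hB.det_pos
  rw [normalPdf, normalPdf, normalPdf, mul_mul_mul_comm, ← mul_inv, ← Real.exp_add,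
    ← Real.sqrt_mul (by positivity), inv_fromBlocks_zero hA'.ne'.isUnit hB'.ne'.isUnit,
    sumElim_sub_sumElim, det_fromBlocks_zero₂₁, fromBlocks_mulVec, Fintype.card_sum, pow_add]
  congr 2
  · ring_nf
  · simp only [Function.comp_def, Sum.elim_inl, Sum.elim_inr, zero_mulVec, add_zero, zero_add,
      sumElim_dotProduct_sumElim]
    ring

end Blocks

/-! ### Matrix identities behind the marginal-posterior factorization -/

section Marginal

variable {m q : ℕ} {D : Matrix (Fin q) (Fin q) ℝ} {S : Matrix (Fin m) (Fin m) ℝ}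

lemma posDef_margDispersion (hD : D.PosDef) (hS : S.PosDef) (Z : Matrix (Fin m) (Fin q) ℝ) :
    (margDispersion D S Z).PosDef := by
  refine hS.add_posSemidef ?_
  simpa [conjTranspose_eq_transpose_of_trivial] using
    hD.posSemidef.mul_mul_conjTranspose_same Z

lemma posDef_inv_add (hD : D.PosDef) (hS : S.PosDef) (Z : Matrix (Fin m) (Fin q) ℝ) :
    (D⁻¹ + Zᵀ * S⁻¹ * Z).PosDef := by
  refine hD.inv.add_posSemidef ?_
  simpa [conjTranspose_eq_transpose_of_trivial] using
    hS.inv.posSemidef.conjTranspose_mul_mul_same Z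

lemma posDef_bigLambda (hD : D.PosDef) (hS : S.PosDef) (Z : Matrix (Fin m) (Fin q) ℝ) :
    (bigLambda D S Z).PosDef :=
  (posDef_inv_add hD hS Z).inv

/-- Two forms of the regression matrix of the random effect on the response; both follow from Λ⁻¹ D
Zᵀ = Zᵀ Σ⁻¹ Ψ. -/
lemma bigLambda_mul_transpose_mul_inv (hD : D.PosDef) (hS : S.PosDef)
    (Z : Matrix (Fin m) (Fin q) ℝ) :
    bigLambda D S Z * Zᵀ * S⁻¹ = D * Zᵀ * (margDispersion D S Z)⁻¹ := by
  have hL := (posDef_inv_add hD hS Z).det_pos.ne'.isUnit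
  have hP := (posDef_margDispersion hD hS Z).det_pos.ne'.isUnit
  have hD' := hD.det_pos.ne'.isUnit
  have hS' := hS.det_pos.ne'.isUnit
  have key : (D⁻¹ + Zᵀ * S⁻¹ * Z) * (D * Zᵀ) = Zᵀ * S⁻¹ * margDispersion D S Z := by
    rw [margDispersion, Matrix.add_mul, Matrix.mul_add, Matrix.nonsing_inv_mul_cancel_left _ _ hD',
      Matrix.nonsing_inv_mul_cancel_right _ _ hS']
    simp only [Matrix.mul_assoc]
  calc bigLambda D S Z * Zᵀ * S⁻¹
      = bigLambda D S Z * (Zᵀ * S⁻¹ * margDispersion D S Z) * (margDispersion D S Z)⁻¹ := by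
        rw [← Matrix.mul_assoc (bigLambda D S Z), Matrix.mul_nonsing_inv_cancel_right _ _ hP,
          Matrix.mul_assoc]
    _ = D * Zᵀ * (margDispersion D S Z)⁻¹ := by
        rw [← key, bigLambda, Matrix.nonsing_inv_mul_cancel_left _ _ hL]

/-- Matrix determinant lemma, with 1 + Zᵀ Σ⁻¹ Z D = Λ⁻¹ D. It matches the normalizing constants in
the factorization. -/
lemma det_margDispersion_mul_det_bigLambda (hD : D.PosDef) (hS : S.PosDef)
    (Z : Matrix (Fin m) (Fin q) ℝ) :
    (margDispersion D S Z).det * (bigLambda D S Z).det = D.det * S.det := by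
  have hL := (posDef_inv_add hD hS Z).det_pos.ne'
  have hD' := hD.det_pos.ne'.isUnit
  have h1 : 1 + Zᵀ * S⁻¹ * (Z * D) = (D⁻¹ + Zᵀ * S⁻¹ * Z) * D := by
    rw [Matrix.add_mul, Matrix.nonsing_inv_mul _ hD', Matrix.mul_assoc _ Z D]
  rw [margDispersion, det_add_mul _ _ hS.det_pos.ne'.isUnit, h1, det_mul, bigLambda,
    det_nonsing_inv, Ring.inverse_eq_inv']
  field_simp

/-- Completing the square in x; the Woodbury identity recognizes the remainder as the quadratic form
of Ψ⁻¹. -/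
lemma margDispersion_quadForm (hD : D.PosDef) (hS : S.PosDef) (Z : Matrix (Fin m) (Fin q) ℝ)
    (x : Fin q → ℝ) (r : Fin m → ℝ) :
    x ⬝ᵥ D⁻¹ *ᵥ x + (r - Z *ᵥ x) ⬝ᵥ S⁻¹ *ᵥ (r - Z *ᵥ x) =
      r ⬝ᵥ (margDispersion D S Z)⁻¹ *ᵥ r +
        (x - (bigLambda D S Z * Zᵀ * S⁻¹) *ᵥ r) ⬝ᵥ
          (bigLambda D S Z)⁻¹ *ᵥ (x - (bigLambda D S Z * Zᵀ * S⁻¹) *ᵥ r) := by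
  have hL := posDef_inv_add hD hS Z
  have hLi : (bigLambda D S Z)⁻¹ = D⁻¹ + Zᵀ * S⁻¹ * Z :=
    Matrix.nonsing_inv_nonsing_inv _ hL.det_pos.ne'.isUnit
  have hwood : (margDispersion D S Z)⁻¹ = S⁻¹ - S⁻¹ * Z * bigLambda D S Z * Zᵀ * S⁻¹ :=
    add_mul_mul_inv_eq_sub S Z D Zᵀ hS.isUnit hD.isUnit hL.isUnit
  set L := D⁻¹ + Zᵀ * S⁻¹ * Z with hLdef
  set a := (bigLambda D S Z * Zᵀ * S⁻¹) *ᵥ r with ha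
  set v := Zᵀ *ᵥ S⁻¹ *ᵥ r with hv
  have hSt : (S⁻¹)ᵀ = S⁻¹ := by
    simpa [conjTranspose_eq_transpose_of_trivial] using hS.inv.isHermitian.eq
  have hLt : Lᵀ = L := by
    simpa [conjTranspose_eq_transpose_of_trivial] using hL.isHermitian.eq
  have hLa : L *ᵥ a = v := by
    rw [ha, mulVec_mulVec, bigLambda, Matrix.mul_assoc,
      Matrix.mul_nonsing_inv_cancel_left _ _ hL.det_pos.ne'.isUnit, hv, mulVec_mulVec]
  have h1 : x ⬝ᵥ L *ᵥ x = x ⬝ᵥ D⁻¹ *ᵥ x + Z *ᵥ x ⬝ᵥ S⁻¹ *ᵥ (Z *ᵥ x) := by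
    rw [hLdef, add_mulVec, dotProduct_add, ← mulVec_mulVec, ← mulVec_mulVec,
      dotProduct_mulVec x Zᵀ, vecMul_transpose]
  have h2 : r ⬝ᵥ S⁻¹ *ᵥ (Z *ᵥ x) = x ⬝ᵥ v := by
    rw [dotProduct_mulVec, ← mulVec_transpose, hSt, dotProduct_mulVec, ← mulVec_transpose,
      dotProduct_comm]
  have h3 : Z *ᵥ x ⬝ᵥ S⁻¹ *ᵥ r = x ⬝ᵥ v := by
    rw [hv, dotProduct_mulVec x, vecMul_transpose]
  have h4 : a ⬝ᵥ L *ᵥ x = x ⬝ᵥ v := by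
    rw [dotProduct_mulVec, ← mulVec_transpose, hLt, hLa, dotProduct_comm]
  have h5 : r ⬝ᵥ (margDispersion D S Z)⁻¹ *ᵥ r = r ⬝ᵥ S⁻¹ *ᵥ r - a ⬝ᵥ v := by
    rw [hwood, sub_mulVec, dotProduct_sub]
    congr 1
    rw [Matrix.mul_assoc, Matrix.mul_assoc, Matrix.mul_assoc, ← Matrix.mul_assoc (bigLambda D S Z),
      ← mulVec_mulVec, ← mulVec_mulVec, ← ha, hv, dotProduct_mulVec, ← mulVec_transpose, hSt,
      dotProduct_mulVec, ← mulVec_transpose, dotProduct_comm]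
  rw [h5, hLi]
  simp only [mulVec_sub, dotProduct_sub, sub_dotProduct, h1, h2, h3, h4, hLa]
  ring

/-- Bayes' rule for the Gaussian linear model: prior times likelihood is marginal times posterior.
-/
lemma normalPdf_mul_normalPdf (hD : D.PosDef) (hS : S.PosDef) (Z : Matrix (Fin m) (Fin q) ℝ)
    (μ x : Fin q → ℝ) (r : Fin m → ℝ) :
    normalPdf μ D x * normalPdf 0 S (r - Z *ᵥ x) =
      normalPdf (Z *ᵥ μ) (margDispersion D S Z) r *
        normalPdf (μ + (bigLambda D S Z * Zᵀ * S⁻¹) *ᵥ (r - Z *ᵥ μ)) (bigLambda D S Z) x := by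
  have hD' := hD.det_pos
  have hP' := (posDef_margDispersion hD hS Z).det_pos
  have h := margDispersion_quadForm hD hS Z (x - μ) (r - Z *ᵥ μ)
  have hd := det_margDispersion_mul_det_bigLambda hD hS Z
  rw [show r - Z *ᵥ μ - Z *ᵥ (x - μ) = r - Z *ᵥ x by rw [mulVec_sub]; abel, sub_sub x μ] at h
  simp only [normalPdf]
  rw [mul_mul_mul_comm, mul_mul_mul_comm (√(_ * (margDispersion D S Z).det))⁻¹, ← mul_inv,
    ← mul_inv, ← Real.exp_add, ← Real.exp_add,
    ← Real.sqrt_mul (by positivity), ← Real.sqrt_mul (by positivity), ← mul_add, ← mul_add,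
    sub_zero, h]
  congr 3
  linear_combination
    -((2 * Real.pi) ^ Fintype.card (Fin q) * (2 * Real.pi) ^ Fintype.card (Fin m)) * hd

lemma margDispersion_smul (u : ℝ) (Z : Matrix (Fin m) (Fin q) ℝ) :
    margDispersion (u • D) (u • S) Z = u • margDispersion D S Z := by
  simp [margDispersion]

lemma bigLambda_inv_smul (hD : D.PosDef) (hS : S.PosDef) (u : ℝ)
    (Z : Matrix (Fin m) (Fin q) ℝ) :
    bigLambda (u⁻¹ • D) (u⁻¹ • S) Z = u⁻¹ • bigLambda D S Z := by
  have h := inv_inv_smul (posDef_inv_add hD hS Z).det_pos.ne'.isUnit u⁻¹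
  rw [inv_inv] at h
  rw [bigLambda, inv_inv_smul hD.det_pos.ne'.isUnit, inv_inv_smul hS.det_pos.ne'.isUnit, bigLambda,
    ← h, smul_add, Matrix.mul_smul, Matrix.smul_mul]

lemma margSkewness_dotProduct (hD : D.PosDef) (hS : S.PosDef) (Z : Matrix (Fin m) (Fin q) ℝ)
    (lam : Fin q → ℝ) (r : Fin m → ℝ) :
    margSkewness D S Z lam ⬝ᵥ matInvSqrt (margDispersion D S Z) *ᵥ r =
      (√(1 + zetaVec D lam ⬝ᵥ bigLambda D S Z *ᵥ zetaVec D lam))⁻¹ *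
        (zetaVec D lam ⬝ᵥ (bigLambda D S Z * Zᵀ * S⁻¹) *ᵥ r) := by
  have hDt : Dᵀ = D := by
    simpa [conjTranspose_eq_transpose_of_trivial] using hD.isHermitian.eq
  rw [margSkewness, smul_dotProduct, smul_eq_mul]
  congr 1
  rw [bigLambda_mul_transpose_mul_inv hD hS, ← matInvSqrt_mul_self (posDef_margDispersion hD hS Z),
    dotProduct_comm, dotProduct_mulVec, ← mulVec_transpose, dotProduct_comm, mulVec_mulVec]
  simp only [transpose_mul, transpose_matInvSqrt, hDt, Matrix.mul_assoc]

end Marginal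

/-! ### Joint measurability in the point and the mixing variable, for Tonelli -/

section Measurability

lemma measurable_sumElim {α ι κ : Type*} [MeasurableSpace α] {f : α → ι → ℝ} {g : α → κ → ℝ}
    (hf : Measurable f) (hg : Measurable g) : Measurable fun a => Sum.elim (f a) (g a) := by
  rw [measurable_pi_iff] at *
  rintro (i | i)
  exacts [hf i, hg i]

variable {ι : Type*} [Fintype ι] [DecidableEq ι]

lemma measurable_smsn_integrand (μ : ι → ℝ) {S : Matrix ι ι ℝ} (hS : S.PosDef) (lam : ι → ℝ) :
    Measurable fun p : (ι → ℝ) × ℝ => ENNReal.ofReal (normalPdf μ (p.2⁻¹ • S) p.1 *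
      stdNormalCdf (√p.2 * (lam ⬝ᵥ matInvSqrt S *ᵥ (p.1 - μ)))) := by
  have hcdf := measurable_stdNormalCdf
  have hlin : Measurable fun p : (ι → ℝ) × ℝ => lam ⬝ᵥ matInvSqrt S *ᵥ (p.1 - μ) :=
    Continuous.measurable (by fun_prop)
  have hq : Measurable fun p : (ι → ℝ) × ℝ => (p.1 - μ) ⬝ᵥ S⁻¹ *ᵥ (p.1 - μ) :=
    Continuous.measurable (by fun_prop)
  simp only [normalPdf, det_smul, inv_inv_smul hS.det_pos.ne'.isUnit, smul_mulVec,
    dotProduct_smul, smul_eq_mul]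
  fun_prop

lemma measurable_smsnPdf (μ : ι → ℝ) {S : Matrix ι ι ℝ} (hS : S.PosDef) (lam : ι → ℝ)
    (H : Measure ℝ) [SFinite H] : Measurable (smsnPdf μ S lam H) :=
  (measurable_smsn_integrand μ hS lam).lintegral_prod_right'.const_mul 2

end Measurability

/-! ### Integrating out the random effect -/

section Marginal

variable {m q : ℕ} {D : Matrix (Fin q) (Fin q) ℝ} {S : Matrix (Fin m) (Fin m) ℝ}

lemma lintegral_smsn_integrand (hD : D.PosDef) (hS : S.PosDef) (Z : Matrix (Fin m) (Fin q) ℝ)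
    (lam μ : Fin q → ℝ) (v y : Fin m → ℝ) {u : ℝ} (hu : 0 < u) :
    ∫⁻ x : Fin q → ℝ, ENNReal.ofReal
        (normalPdf (Sum.elim μ 0) (u⁻¹ • fromBlocks D 0 0 S) (Sum.elim x (y - (v + Z *ᵥ x))) *
          stdNormalCdf (√u * (Sum.elim lam 0 ⬝ᵥ matInvSqrt (fromBlocks D 0 0 S) *ᵥ
            (Sum.elim x (y - (v + Z *ᵥ x)) - Sum.elim μ 0)))) =
      ENNReal.ofReal (normalPdf (v + Z *ᵥ μ) (u⁻¹ • margDispersion D S Z) y *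
        stdNormalCdf (√u * (margSkewness D S Z lam ⬝ᵥ
          matInvSqrt (margDispersion D S Z) *ᵥ (y - (v + Z *ᵥ μ))))) := by
  have hu' := inv_pos.2 hu
  have hDu := hD.smul hu'
  have hSu := hS.smul hu'
  have hcdf := measurable_stdNormalCdf
  have hdot : Measurable fun x : Fin q → ℝ => (√u • zetaVec D lam) ⬝ᵥ x :=
    Continuous.measurable (by fun_prop)
  set a := μ + (bigLambda D S Z * Zᵀ * S⁻¹) *ᵥ (y - (v + Z *ᵥ μ)) with ha
  set α := -((√u • zetaVec D lam) ⬝ᵥ μ) with hα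
  -- The regression matrix is unchanged by a common rescaling of D and Σ, so the posterior mean does
  -- not involve u.
  have hmat : bigLambda (u⁻¹ • D) (u⁻¹ • S) Z * Zᵀ * (u⁻¹ • S)⁻¹ = bigLambda D S Z * Zᵀ * S⁻¹ := by
    rw [bigLambda_inv_smul hD hS, inv_inv_smul hS.det_pos.ne'.isUnit, Matrix.smul_mul,
      Matrix.smul_mul, Matrix.mul_smul, inv_smul_smul₀ hu.ne']
  have hpdf : ∀ x, normalPdf (Sum.elim μ 0) (u⁻¹ • fromBlocks D 0 0 S)
      (Sum.elim x (y - (v + Z *ᵥ x))) =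
      normalPdf (v + Z *ᵥ μ) (u⁻¹ • margDispersion D S Z) y *
        normalPdf a (u⁻¹ • bigLambda D S Z) x := fun x => by
    rw [fromBlocks_smul, smul_zero, smul_zero, normalPdf_fromBlocks hDu hSu, ← sub_sub,
      normalPdf_mul_normalPdf hDu hSu, hmat, margDispersion_smul, bigLambda_inv_smul hD hS, sub_sub]
    congr 1
    -- The density depends on point and mean only through their difference, so v can move from one
    -- to the other.
    simp only [normalPdf, sub_sub]
  have harg : ∀ x, √u * (Sum.elim lam 0 ⬝ᵥ matInvSqrt (fromBlocks D 0 0 S) *ᵥ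
      (Sum.elim x (y - (v + Z *ᵥ x)) - Sum.elim μ 0)) = α + (√u • zetaVec D lam) ⬝ᵥ x := fun x => by
    rw [matInvSqrt_fromBlocks hD hS, sumElim_sub_sumElim, fromBlocks_mulVec,
      sumElim_dotProduct_sumElim, zero_dotProduct, add_zero]
    simp only [Function.comp_def, Sum.elim_inl, Sum.elim_inr, zero_mulVec, add_zero]
    rw [dotProduct_mulVec, ← mulVec_transpose, transpose_matInvSqrt, ← zetaVec, hα,
      smul_dotProduct, smul_dotProduct, dotProduct_sub, smul_eq_mul, smul_eq_mul]
    ring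
  have hnn := normalPdf_nonneg (v + Z *ᵥ μ) (u⁻¹ • margDispersion D S Z) y
  simp only [hpdf, harg]
  simp_rw [mul_assoc, ENNReal.ofReal_mul hnn, ENNReal.ofReal_mul (normalPdf_nonneg _ _ _)]
  rw [lintegral_const_mul _ (by fun_prop),
    lintegral_normalPdf_mul_stdNormalCdf a ((posDef_bigLambda hD hS Z).smul hu')]
  congr 3
  -- The cancellation that makes the marginal skewness the same for every u.
  have hquad : (√u • zetaVec D lam) ⬝ᵥ (u⁻¹ • bigLambda D S Z) *ᵥ (√u • zetaVec D lam) =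
      zetaVec D lam ⬝ᵥ bigLambda D S Z *ᵥ zetaVec D lam := by
    simp only [smul_mulVec, mulVec_smul, dotProduct_smul, smul_dotProduct, smul_eq_mul]
    rw [← mul_assoc, ← mul_assoc, mul_right_comm √u, Real.mul_self_sqrt hu.le,
      mul_inv_cancel₀ hu.ne', one_mul]
  rw [hquad, margSkewness_dotProduct hD hS, hα, ha, dotProduct_add, smul_dotProduct,
    smul_dotProduct, smul_eq_mul, smul_eq_mul]
  ring

/-- Integrating the random effect out of the joint density yields the marginal density. -/
lemma lintegral_smsnPdf_fromBlocks (hD : D.PosDef) (hS : S.PosDef) (Z : Matrix (Fin m) (Fin q) ℝ)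
    (lam μ : Fin q → ℝ) (v y : Fin m → ℝ) (H : Measure ℝ) [SFinite H] :
    ∫⁻ x : Fin q → ℝ, smsnPdf (Sum.elim μ 0) (fromBlocks D 0 0 S) (Sum.elim lam 0) H
        (Sum.elim x (y - (v + Z *ᵥ x))) =
      smsnPdf (v + Z *ᵥ μ) (margDispersion D S Z) (margSkewness D S Z lam) H y := by
  have hpd : (fromBlocks D 0 0 S).PosDef := posDef_fromBlocks_zero hD hS
  have hmap : Measurable fun x : Fin q → ℝ =>
      (Sum.elim x (y - (v + Z *ᵥ x)) : Fin q ⊕ Fin m → ℝ) :=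
    measurable_sumElim measurable_id (Continuous.measurable (by fun_prop))
  unfold smsnPdf
  rw [lintegral_const_mul, lintegral_lintegral_swap]
  · congr 1
    exact setLIntegral_congr_fun measurableSet_Ioi fun u hu =>
      lintegral_smsn_integrand hD hS Z lam μ v y hu
  · exact ((measurable_smsn_integrand _ hpd _).comp
      ((hmap.comp measurable_fst).prodMk measurable_snd)).aemeasurable
  · exact ((measurable_smsn_integrand _ hpd _).comp
      ((hmap.comp measurable_fst).prodMk measurable_snd)).lintegral_prod_right'

/-- The law is computed on indicators: for each fixed x, passing from the error e to y = v + Zx + e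
is a translation, which preserves Lebesgue measure. -/
lemma map_smsn_fromBlocks (hD : D.PosDef) (hS : S.PosDef) (Z : Matrix (Fin m) (Fin q) ℝ)
    (lam μ : Fin q → ℝ) (v : Fin m → ℝ) (H : Measure ℝ) [SFinite H] :
    (smsn (Sum.elim μ 0) (fromBlocks D 0 0 S) (Sum.elim lam 0) H).map
        (fun w => v + Z *ᵥ (w ∘ Sum.inl) + w ∘ Sum.inr) =
      smsn (v + Z *ᵥ μ) (margDispersion D S Z) (margSkewness D S Z lam) H := by
  have hT : Measurable fun w : Fin q ⊕ Fin m → ℝ => v + Z *ᵥ (w ∘ Sum.inl) + w ∘ Sum.inr :=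
    Continuous.measurable (by fun_prop)
  have hf := measurable_smsnPdf (Sum.elim μ 0) (posDef_fromBlocks_zero hD hS) (Sum.elim lam 0) H
  set f := smsnPdf (Sum.elim μ 0) (fromBlocks D 0 0 S) (Sum.elim lam 0) H with hfdef
  ext A hA
  have hind : Measurable (A.indicator (1 : (Fin m → ℝ) → ENNReal)) := measurable_one.indicator hA
  have hE := volume_measurePreserving_sumPiEquivProdPi_symm (fun _ : Fin q ⊕ Fin m => ℝ)
  have hF : Measurable fun p : (Fin q → ℝ) × (Fin m → ℝ) =>
      f (Sum.elim p.1 p.2) * A.indicator 1 (v + Z *ᵥ p.1 + p.2) :=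
    (hf.comp (measurable_sumElim measurable_fst measurable_snd)).mul
      (hind.comp (Continuous.measurable (by fun_prop)))
  have hG : Measurable fun p : (Fin q → ℝ) × (Fin m → ℝ) =>
      f (Sum.elim p.1 (p.2 - (v + Z *ᵥ p.1))) * A.indicator 1 p.2 :=
    (hf.comp (measurable_sumElim measurable_fst (Continuous.measurable (by fun_prop)))).mul
      (hind.comp measurable_snd)
  calc (smsn (Sum.elim μ 0) (fromBlocks D 0 0 S) (Sum.elim lam 0) H).map
        (fun w => v + Z *ᵥ (w ∘ Sum.inl) + w ∘ Sum.inr) A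
      = ∫⁻ w, f w * A.indicator 1 (v + Z *ᵥ (w ∘ Sum.inl) + w ∘ Sum.inr) := by
        rw [← lintegral_indicator_one hA, lintegral_map hind hT, smsn]
        exact lintegral_withDensity_eq_lintegral_mul _ hf (hind.comp hT)
    _ = ∫⁻ x : Fin q → ℝ, ∫⁻ e : Fin m → ℝ,
          f (Sum.elim x e) * A.indicator 1 (v + Z *ᵥ x + e) := by
        rw [← hE.lintegral_comp_emb (MeasurableEquiv.measurableEmbedding _), Measure.volume_eq_prod,
          ← lintegral_prod _ hF.aemeasurable]
        rfl
    _ = ∫⁻ x : Fin q → ℝ, ∫⁻ y : Fin m → ℝ,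
          f (Sum.elim x (y - (v + Z *ᵥ x))) * A.indicator 1 y := by
        refine lintegral_congr fun x => ?_
        rw [← lintegral_sub_right_eq_self _ (v + Z *ᵥ x)]
        simp only [add_sub_cancel]
    _ = ∫⁻ y : Fin m → ℝ, smsnPdf (v + Z *ᵥ μ) (margDispersion D S Z)
          (margSkewness D S Z lam) H y * A.indicator 1 y := by
        rw [lintegral_lintegral_swap hG.aemeasurable]
        refine lintegral_congr fun y => ?_
        rw [← lintegral_smsnPdf_fromBlocks hD hS Z lam μ v y H, lintegral_mul_const]
        exact hf.comp (measurable_sumElim measurable_id (Continuous.measurable (by fun_prop)))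
    _ = smsn (v + Z *ᵥ μ) (margDispersion D S Z) (margSkewness D S Z lam) H A := by
        rw [smsn, ← lintegral_indicator_one hA, lintegral_withDensity_eq_lintegral_mul _
          (measurable_smsnPdf _ (posDef_margDispersion hD hS Z) _ H) hind]
        rfl

lemma margLocation_eq {l : ℕ} (X : Matrix (Fin m) (Fin l) ℝ) (β : Fin l → ℝ)
    (Z : Matrix (Fin m) (Fin q) ℝ) (lam : Fin q → ℝ) (H : Measure ℝ) :
    margLocation X β Z D lam H = X *ᵥ β + Z *ᵥ (centering H • bigDelta D lam) := by
  rw [margLocation, mulVec_smul]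
end Marginal

/-! ### Marginal law of the responses in the mixed model -/

theorem mainTheorem1
    {Ω : Type*} [MeasurableSpace Ω] (P : Measure Ω) [IsProbabilityMeasure P]
    -- `N` subjects with `n i` observations each, `l` fixed and `q` random effects
    (N l q : ℕ) (n : Fin N → ℕ)
    -- the mixing distribution: the law of a positive random variable with `E[U^{-1/2}] < ∞`
    (H : Measure ℝ) [IsProbabilityMeasure H] (hHpos : ∀ᵐ u ∂H, 0 < u)
    (hHk : Integrable (fun u : ℝ => (√u)⁻¹) H)
    -- design matrices and parameters
    (X : ∀ i, Matrix (Fin (n i)) (Fin l) ℝ) (Z : ∀ i, Matrix (Fin (n i)) (Fin q) ℝ)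
    (β : Fin l → ℝ) (lam : Fin q → ℝ)
    (D : Matrix (Fin q) (Fin q) ℝ) (hD : D.PosDef)
    (S : ∀ i, Matrix (Fin (n i)) (Fin (n i)) ℝ) (hS : ∀ i, (S i).PosDef)
    -- random effects, errors and responses
    (b : Fin N → Ω → Fin q → ℝ) (ε : ∀ i, Ω → Fin (n i) → ℝ) (Y : ∀ i, Ω → Fin (n i) → ℝ)
    (hlaw : ∀ i, HasLaw (fun ω => Sum.elim (b i ω) (ε i ω))
      (smsn (Sum.elim (centering H • bigDelta D lam) 0) (fromBlocks D 0 0 (S i))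
        (Sum.elim lam 0) H) P)
    (hindep : iIndepFun
      (fun i ω => (Sum.elim (b i ω) (ε i ω) : Fin q ⊕ Fin (n i) → ℝ)) P)
    (hY : ∀ i ω, Y i ω = X i *ᵥ β + Z i *ᵥ b i ω + ε i ω) :
    iIndepFun Y P ∧
    ∀ i,
      HasLaw (Y i)
        (smsn (margLocation (X i) β (Z i) D lam H) (margDispersion D (S i) (Z i))
          (margSkewness D (S i) (Z i) lam) H) P ∧
      HasPDF (Y i) P volume ∧
      pdf (Y i) P volume =ᵐ[volume] fun y =>
        2 * ∫⁻ u in Set.Ioi (0 : ℝ), ENNReal.ofReal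
          (normalPdf (X i *ᵥ β + centering H • Z i *ᵥ bigDelta D lam)
              (u⁻¹ • margDispersion D (S i) (Z i)) y *
            stdNormalCdf (√u * (margSkewness D (S i) (Z i) lam ⬝ᵥ
              matInvSqrt (margDispersion D (S i) (Z i)) *ᵥ
                (y - X i *ᵥ β - centering H • Z i *ᵥ bigDelta D lam)))) ∂H := by
  set φ : ∀ i, (Fin q ⊕ Fin (n i) → ℝ) → Fin (n i) → ℝ := fun i w =>
    X i *ᵥ β + Z i *ᵥ (w ∘ Sum.inl) + w ∘ Sum.inr with hφ
  have hφm : ∀ i, Measurable (φ i) := fun i => Continuous.measurable (by fun_prop)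
  have hYφ : ∀ i, Y i = φ i ∘ fun ω => Sum.elim (b i ω) (ε i ω) := fun i => funext fun ω => by
    simp [hφ, hY i ω]
  refine ⟨?_, fun i => ?_⟩
  · rw [funext hYφ]
    exact hindep.comp φ hφm
  have hlawY : HasLaw (Y i) (smsn (margLocation (X i) β (Z i) D lam H)
      (margDispersion D (S i) (Z i)) (margSkewness D (S i) (Z i) lam) H) P := by
    refine ⟨hYφ i ▸ (hφm i).comp_aemeasurable (hlaw i).aemeasurable, ?_⟩
    rw [hYφ i, ← AEMeasurable.map_map_of_aemeasurable (hφm i).aemeasurable (hlaw i).aemeasurable,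
      (hlaw i).map_eq, map_smsn_fromBlocks hD (hS i), margLocation_eq]
  have hm := (measurable_smsnPdf (margLocation (X i) β (Z i) D lam H)
    (posDef_margDispersion hD (hS i) (Z i)) (margSkewness D (S i) (Z i) lam) H).aemeasurable
      (μ := volume)
  have hpdf : HasPDF (Y i) P volume :=
    hasPDF_of_map_eq_withDensity hlawY.aemeasurable _ hm hlawY.map_eq
  refine ⟨hlawY, hpdf, ?_⟩
  simp_rw [sub_sub]
  exact (pdf.eq_of_map_eq_withDensity _ hm).1 hlawY.map_eq
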